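/- Let $X$ be a Euclidean space with closed unit ball $B$. For a function $f\colon X\to\mathbb{R}$ that is Lipschitz near the points considered, the Clarke subdifferential $\partial f(x)$ is the closed convex hull of all limits $\lim_r \nabla f(u_r)$ along sequences $u_r\to x$ of points at which $f$ is differentiable; for $\varepsilon\ge 0$, the Goldstein subgradient $g_\varepsilon(x)$ is the shortest vector in $\mathrm{conv}\,\partial f(x+\varepsilon B)$. A function $f\colon X\to\mathbb{R}$ is a *strong $\mathcal{C}^2$ max function* at $\bar x\in X$ if 1. $\bar x$ is Clarke critical and nondegenerate: $0\in\mathrm{ri}\,\partial f(\bar x)$; 2. $f$ grows quadratically at $\bar x$: for some $\delta>0$, $f(x)-f(\bar x)\ge\frac{\delta}{2}|x-\bar x|^2$ for all $x$ near $\bar x$; 3. there are finitely many $\mathcal{C}^2$-smooth functions $f_i\colon X\to\mathbb{R}$ ($i\in I$) such that $f(x)=\max_{i\in I}f_i(x)$ for all $x$ near $\bar x$, the values $f_i(\bar x)$ ($i\in I$) are all equal, and the family of gradients $\nabla f_i(\bar x)$ ($i\in I$) is affinely independent. In that case the *active manifold* is $\mathcal{M}=\{x\in X : \text{the values } f_i(x)\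 (i\in I) \text{ are all equal}\}$. **Theorem.** Let $f$ be a strong $\mathcal{C}^2$ max function at $\bar x$ with active manifold $\mathcal{M}$. Then $f$ has tempered growth at $\bar x$ relative to $\mathcal{M}$, that is: $\mathcal{M}$ is a $\mathcal{C}^2$-smooth manifold around $\bar x\in\mathcal{M}$, $f$ is Lipschitz near $\bar x$, the restriction $f|_{\mathcal{M}}$ is $\mathcal{C}^2$-smooth around $\bar x$, and for every angle $\theta>0$ there is $\beta_0>0$ such that for every $\beta\in(0,\beta_0)$ the following holds. For all sequences of points $\bar x\ne x_r\to\bar x$ and of radii $0\le\varepsilon_r\le\beta|x_r-\bar x|$ whose Goldstein subgradients $g_{\varepsilon_r}(x_r)$ exist and converge to $0$, for all large $r$ the point $x_r$ has a unique nearest point $P_{\mathcal{M}}(x_r)$ in $\mathcal{M}$, the vector $g_{\varepsilon_r}(x_r)$ and the Riemannian gradient $\nabla_{\mathcal{M}}f(P_{\mathcal{M}}(x_r))$ of $f|_{\mathcal{M}}$ are both nonzero, and the angle between them is less than $\theta$. -/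

import Mathlib

open Filter Topology

section TemperedGrowth

variable {X : Type*} [NormedAddCommGroup X] [InnerProductSpace ℝ X] [FiniteDimensional ℝ X]

/-- The Clarke subdifferential `∂f(x)`: the closed convex hull of all limits of gradients `∇f(u r)`
along sequences `u r → x` of points at which `f` is differentiable. -/
def clarkeSubdifferential (f : X → ℝ) (x : X) : Set X :=
  closure (convexHull ℝ
    {v : X | ∃ u : ℕ → X, (∀ r, DifferentiableAt ℝ f (u r)) ∧ Tendsto u atTop (𝓝 x) ∧
      Tendsto (fun r => gradient f (u r)) atTop (𝓝 v)})

/-- The Goldstein subdifferential `∂_ε f(x) = conv (∂f(x + ε B))`, for a radius `ε ≥ 0`. -/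
def goldsteinSubdifferential (f : X → ℝ) (ε : ℝ) (x : X) : Set X :=
  convexHull ℝ (⋃ y ∈ Metric.closedBall x ε, clarkeSubdifferential f y)

/-- `g` is the Goldstein subgradient `g_ε(x)`: the shortest vector in `∂_ε f(x)`. -/
def IsGoldsteinSubgradient (f : X → ℝ) (ε : ℝ) (x g : X) : Prop :=
  g ∈ goldsteinSubdifferential f ε x ∧ ∀ v ∈ goldsteinSubdifferential f ε x, ‖g‖ ≤ ‖v‖

/-- `f` grows quadratically at `xbar`. -/
def GrowsQuadratically (f : X → ℝ) (xbar : X) : Prop :=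
  ∃ δ : ℝ, 0 < δ ∧ ∀ᶠ x in 𝓝 xbar, δ / 2 * ‖x - xbar‖ ^ 2 ≤ f x - f xbar

/-- `f` is a strong `C²` max function at `xbar`, and the finite family `F` is a representation
of `f` around `xbar` as required in that definition. -/
structure IsStrongC2MaxFunction {ι : Type*} [Finite ι] (f : X → ℝ) (F : ι → X → ℝ)
    (xbar : X) : Prop where
  clarkeCritical : (0 : X) ∈ clarkeSubdifferential f xbar
  nondegenerate : (0 : X) ∈ intrinsicInterior ℝ (clarkeSubdifferential f xbar)
  growsQuadratically : GrowsQuadratically f xbar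
  contDiff : ∀ i, ContDiff ℝ 2 (F i)
  eq_max : ∀ᶠ x in 𝓝 xbar, IsGreatest (Set.range fun i => F i x) (f x)
  values_eq : ∀ i j, F i xbar = F j xbar
  affineIndependent : AffineIndependent ℝ fun i => gradient (F i) xbar

/-- The active manifold: the set of points where the values `F i x` are all equal. -/
def activeManifold {ι : Type*} (F : ι → X → ℝ) : Set X :=
  {x | ∀ i j, F i x = F j x}

/-- `M` is a `C²`-smooth manifold around `xbar ∈ M`: near `xbar` it is the zero set of a
`C²` map into some `ℝᵏ` whose derivative at `xbar` is surjective. -/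
def IsC2ManifoldAround (M : Set X) (xbar : X) : Prop :=
  xbar ∈ M ∧ ∃ (k : ℕ) (Φ : X → EuclideanSpace ℝ (Fin k)), ContDiffAt ℝ 2 Φ xbar ∧
    Function.Surjective (fderiv ℝ Φ xbar) ∧ ∀ᶠ x in 𝓝 xbar, (x ∈ M ↔ Φ x = 0)

/-- The restriction of `f` to `M` is `C²`-smooth around `xbar`: near `xbar` it is the restriction
of a `C²` function on the ambient space. -/
def IsC2RestrictionAround (f : X → ℝ) (M : Set X) (xbar : X) : Prop :=
  ∃ h : X → ℝ, ContDiffAt ℝ 2 h xbar ∧ ∀ᶠ x in 𝓝 xbar, x ∈ M → f x = h x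

/-- `f` is Lipschitz on some neighbourhood of `xbar`. -/
def IsLipschitzAround (f : X → ℝ) (xbar : X) : Prop :=
  ∃ K : NNReal, ∃ U ∈ 𝓝 xbar, LipschitzOnWith K f U

/-- `p` is a point of `M` nearest to `x`. -/
def IsNearestPoint (M : Set X) (x p : X) : Prop :=
  p ∈ M ∧ ∀ q ∈ M, ‖x - p‖ ≤ ‖x - q‖

/-- `p = P_M(x)`: the point `p` is the unique point of `M` nearest to `x`. -/
def IsProjection (M : Set X) (x p : X) : Prop :=
  IsNearestPoint M x p ∧ ∀ q, IsNearestPoint M x q → q = p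

/-- The tangent space to `M` at `p` (for a manifold the tangent cone is already a subspace). -/
def tangentSpaceOf (M : Set X) (p : X) : Submodule ℝ X :=
  Submodule.span ℝ (tangentConeAt ℝ M p)

/-- `v` is the Riemannian gradient at `p ∈ M` of the restriction of `f` to `M`, with the metric
induced from `X`: the tangent vector that represents the derivative of `f` along `M` at `p`. -/
def IsRiemannianGradient (f : X → ℝ) (M : Set X) (p v : X) : Prop :=
  p ∈ M ∧ v ∈ tangentSpaceOf M p ∧ HasGradientWithinAt f v M p

/-- `f` has tempered growth at `xbar` relative to `M`. -/
def HasTemperedGrowth (f : X → ℝ) (M : Set X) (xbar : X) : Prop :=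
  IsC2ManifoldAround M xbar ∧ IsLipschitzAround f xbar ∧ IsC2RestrictionAround f M xbar ∧
  ∀ θ : ℝ, 0 < θ → ∃ β₀ : ℝ, 0 < β₀ ∧ ∀ β : ℝ, 0 < β → β < β₀ →
    ∀ (x : ℕ → X) (ε : ℕ → ℝ) (g : ℕ → X),
      (∀ r, x r ≠ xbar) → Tendsto x atTop (𝓝 xbar) →
      (∀ r, 0 ≤ ε r ∧ ε r ≤ β * ‖x r - xbar‖) →
      (∀ r, IsGoldsteinSubgradient f (ε r) (x r) (g r)) → Tendsto g atTop (𝓝 0) →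
      ∀ᶠ r in atTop, ∃ p v : X, IsProjection M (x r) p ∧ IsRiemannianGradient f M p v ∧
        g r ≠ 0 ∧ v ≠ 0 ∧ InnerProductGeometry.angle (g r) v < θ

end TemperedGrowth

/-!
# Tempered growth of strong `C²` max functions

Write `aᵢ = ∇Fᵢ(xbar)`. Nondegeneracy and affine independence give multipliers `lᵢ > 0` with
`∑ lᵢ = 1` and `∑ lᵢ aᵢ = 0` (`IsStrongC2MaxFunction.exists_pos_multipliers`); this uses that every
`aᵢ` really belongs to the Clarke subdifferential, because affine independence makes each piece
strictly the largest one in some direction (`gradient_mem_clarkeSubdifferential`).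

Near `xbar`, Clarke subgradients are convex combinations of gradients of active pieces. Since all
multipliers are positive, a Goldstein subgradient `g_ε(x)` close to `0` must involve every piece:
without the piece `i` it would lie in a half-space away from `0`
(`IsStrongC2MaxFunction.exists_active_of_mem_convexHull`). Hence each `Fᵢ` is active at some point
`zᵢ` within distance `ε` of `x`, the values `Fᵢ(x)` agree up to `O(ε)`, and metric regularity of
the equations that define the active manifold `M` shows that the projection `p` of `x` onto `M` is
within `O(ε)` of `x` (`activeManifold_error_bound_and_tangent`). The same regularity identifies
enough tangent directions of `M`, which makes the displacement to a nearest point normal and the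
projection unique (`eventually_isNearestPoint_unique`).

The gradients `∇Fᵢ(p)` have a common tangential component `v`, the Riemannian gradient at `p`.
It is a convex combination `∑ wᵢ ∇Fᵢ(p)`, with `w` close to the multipliers, and quadratic growth
forces `‖v‖ ≥ m ‖p - xbar‖` with a constant `m > 0`
(`IsStrongC2MaxFunction.exists_riemannian_gradient_weights`).

With `ε ≤ β ‖x - xbar‖`, gradients at points of the ball around `x` differ from those at `p` by
`O(β) ‖v‖`. So every Goldstein subgradient has inner product at least `(1 - O(β)) ‖v‖²` with `v`,
while the competitor `∑ wᵢ ∇Fᵢ(zᵢ)` shows that the shortest one has length at most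
`(1 + O(β)) ‖v‖` (`IsStrongC2MaxFunction.exists_goldstein_comparison`). These two bounds make the
angle between `g_ε(x)` and `v` small (`angle_lt_of_inner_ge`).
-/

/-! ### Angles, affinely independent families and convex weights -/

section EuclideanGeometry

variable {X : Type*} [NormedAddCommGroup X] [InnerProductSpace ℝ X]

/-- A vector `g` that is almost as short as its component along `v` makes a small angle with `v`. -/
theorem angle_lt_of_inner_ge {g v : X} {θ τ : ℝ} (hθ : 0 < θ) (hv : v ≠ 0)
    (hτ0 : 0 ≤ τ) (hτ1 : τ < 1) (hτ : 2 * τ < 1 - Real.cos θ)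
    (hinner : (1 - τ) * ‖v‖ ^ 2 ≤ inner ℝ g v) (hnorm : ‖g‖ ≤ (1 + τ) * ‖v‖) :
    g ≠ 0 ∧ InnerProductGeometry.angle g v < θ := by
  have hvpos : 0 < ‖v‖ := norm_pos_iff.mpr hv
  have hg : g ≠ 0 := by
    rintro rfl
    rw [inner_zero_left] at hinner
    have : 0 < (1 - τ) * ‖v‖ ^ 2 := by have := sub_pos.mpr hτ1; positivity
    linarith
  refine ⟨hg, ?_⟩
  have hgpos : 0 < ‖g‖ := norm_pos_iff.mpr hg
  have hcos : Real.cos θ < Real.cos (InnerProductGeometry.angle g v) := by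
    rw [InnerProductGeometry.cos_angle, lt_div_iff₀ (by positivity)]
    have h1 : (1 - 2 * τ) * (1 + τ) ≤ 1 - τ := by nlinarith
    have hgv : ‖g‖ * ‖v‖ ≤ (1 + τ) * ‖v‖ ^ 2 := by nlinarith
    rcases le_or_gt (Real.cos θ) 0 with hc | hc
    · have h2 : Real.cos θ * (‖g‖ * ‖v‖) ≤ 0 := mul_nonpos_of_nonpos_of_nonneg hc (by positivity)
      have : 0 < (1 - τ) * ‖v‖ ^ 2 := by have := sub_pos.mpr hτ1; positivity
      linarith
    · calc Real.cos θ * (‖g‖ * ‖v‖) ≤ Real.cos θ * ((1 + τ) * ‖v‖ ^ 2) := by gcongr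
        _ < (1 - 2 * τ) * ((1 + τ) * ‖v‖ ^ 2) := by
          apply mul_lt_mul_of_pos_right (by linarith); positivity
        _ = ((1 - 2 * τ) * (1 + τ)) * ‖v‖ ^ 2 := by ring
        _ ≤ (1 - τ) * ‖v‖ ^ 2 := by gcongr
        _ ≤ _ := hinner
  by_contra! hcon
  exact absurd (Real.cos_le_cos_of_nonneg_of_le_pi hθ.le
    (InnerProductGeometry.angle_le_pi g v) hcon) (not_le.mpr hcos)

variable {ι : Type*}

/-- The differences `a j - a i₀` of an affinely independent family can be given any prescribed
inner products with a suitable vector. -/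
theorem AffineIndependent.exists_inner_sub_eq [FiniteDimensional ℝ X] {a : ι → X}
    (ha : AffineIndependent ℝ a) (i₀ : ι) (t : ι → ℝ) :
    ∃ d : X, ∀ j, j ≠ i₀ → inner ℝ (a j - a i₀) d = t j := by
  have hli := (affineIndependent_iff_linearIndependent_vsub ℝ a i₀).mp ha
  obtain ⟨φ, hφ⟩ := LinearMap.exists_extend
    ((Module.Basis.span hli).constr ℝ fun j : {j // j ≠ i₀} => t j)
  refine ⟨(InnerProductSpace.toDual ℝ X).symm (LinearMap.toContinuousLinearMap φ), fun j hj => ?_⟩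
  rw [real_inner_comm, InnerProductSpace.toDual_symm_apply]
  have h := LinearMap.congr_fun hφ (Module.Basis.span hli ⟨j, hj⟩)
  rw [Module.Basis.constr_basis] at h
  rw [← h]
  simp [Module.Basis.span_apply]

variable [Fintype ι]

theorem mem_vectorSpan_range_iff_of_fintype {w : ι → X} {x : X} :
    x ∈ vectorSpan ℝ (Set.range w) ↔ ∃ c : ι → ℝ, ∑ i, c i = 0 ∧ ∑ i, c i • w i = x := by
  constructor
  · intro hx
    let N : Submodule ℝ X :=
      { carrier := {x | ∃ c : ι → ℝ, ∑ i, c i = 0 ∧ ∑ i, c i • w i = x}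
        add_mem' := by
          rintro _ _ ⟨c, hc, rfl⟩ ⟨d, hd, rfl⟩
          exact ⟨c + d, by simp [Finset.sum_add_distrib, hc, hd],
            by simp [add_smul, Finset.sum_add_distrib]⟩
        zero_mem' := ⟨0, by simp⟩
        smul_mem' := by
          rintro r _ ⟨c, hc, rfl⟩
          exact ⟨r • c, by simp [← Finset.mul_sum, hc], by simp [Finset.smul_sum, smul_smul]⟩ }
    suffices h : vectorSpan ℝ (Set.range w) ≤ N from h hx
    rw [vectorSpan_def, Submodule.span_le]
    rintro _ ⟨_, ⟨i, rfl⟩, _, ⟨j, rfl⟩, rfl⟩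
    classical
    exact ⟨Pi.single i 1 - Pi.single j 1, by simp,
      by simp [sub_smul, Finset.sum_sub_distrib, Pi.single_apply, ite_smul]⟩
  · rintro ⟨c, hc, rfl⟩
    rcases isEmpty_or_nonempty ι with hι | ⟨⟨i₀⟩⟩
    · simp
    · have : ∑ i, c i • w i = ∑ i, c i • (w i - w i₀) := by
        simp [smul_sub, Finset.sum_sub_distrib, ← Finset.sum_smul, hc]
      rw [this]
      exact Submodule.sum_mem _ fun i _ => Submodule.smul_mem _ _
        (vsub_mem_vectorSpan ℝ ⟨i, rfl⟩ ⟨i₀, rfl⟩)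

/-- Quantitative affine independence, uniform over all families close to the given one. -/
theorem AffineIndependent.eventually_sum_abs_le [FiniteDimensional ℝ X] {a : ι → X}
    (ha : AffineIndependent ℝ a) :
    ∃ C : ℝ, 0 < C ∧ ∀ᶠ w in 𝓝 a, ∀ c : ι → ℝ, ∑ i, c i = 0 →
      ∑ i, |c i| ≤ C * ‖∑ i, c i • w i‖ := by
  classical
  choose d hd using fun i => ha.exists_inner_sub_eq i fun _ => -1
  set D : ℝ := ∑ i, ‖d i‖ with hD
  have hD0 : 0 ≤ D := Finset.sum_nonneg fun _ _ => norm_nonneg _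
  -- pairing with `d i` reads off the coefficient `c i`
  have key : ∀ c : ι → ℝ, ∑ i, c i = 0 → ∑ i, |c i| ≤ D * ‖∑ i, c i • a i‖ := by
    intro c hc
    rw [hD, Finset.sum_mul]
    refine Finset.sum_le_sum fun i _ => ?_
    have h1 : inner ℝ (∑ j, c j • a j) (d i) = c i := by
      have : ∑ j, c j • a j = ∑ j, c j • (a j - a i) := by
        simp [smul_sub, Finset.sum_sub_distrib, ← Finset.sum_smul, hc]
      rw [this, sum_inner]
      have h2 : ∀ j, inner ℝ (c j • (a j - a i)) (d i) = if j = i then 0 else -c j := by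
        intro j
        split_ifs with h
        · simp [h]
        · rw [real_inner_smul_left, hd i j h]; ring
      have h3 : ∀ j, (if j = i then 0 else -c j) = (if j = i then c j else 0) - c j := by
        intro j; split_ifs <;> ring
      simp_rw [h2, h3]
      simp [Finset.sum_sub_distrib, hc]
    calc |c i| = |inner ℝ (∑ j, c j • a j) (d i)| := by rw [h1]
      _ ≤ ‖∑ j, c j • a j‖ * ‖d i‖ := abs_real_inner_le_norm _ _
      _ = _ := mul_comm _ _
  refine ⟨2 * (D + 1), by positivity, ?_⟩
  have hball : ∀ᶠ w in 𝓝 a, dist w a < 1 / (2 * (D + 1)) :=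
    Metric.ball_mem_nhds a (by positivity)
  filter_upwards [hball] with w hw c hc
  have hdiff : ‖∑ i, c i • a i - ∑ i, c i • w i‖ ≤ 1 / (2 * (D + 1)) * ∑ i, |c i| := by
    rw [← Finset.sum_sub_distrib, Finset.mul_sum]
    refine norm_sum_le_of_le _ fun i _ => ?_
    rw [← smul_sub, norm_smul, Real.norm_eq_abs, mul_comm]
    gcongr
    rw [← dist_eq_norm, dist_comm]
    exact (dist_le_pi_dist w a i).trans hw.le
  have h1 := key c hc
  have h2 : ‖∑ i, c i • a i‖ ≤ ‖∑ i, c i • w i‖ + ‖∑ i, c i • a i - ∑ i, c i • w i‖ :=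
    norm_le_norm_add_norm_sub' _ _
  have hS : 0 ≤ ∑ i, |c i| := Finset.sum_nonneg fun _ _ => abs_nonneg _
  have h3 : D * (1 / (2 * (D + 1)) * ∑ i, |c i|) ≤ 1 / 2 * ∑ i, |c i| := by
    rw [← mul_assoc]
    gcongr
    rw [mul_one_div, div_le_div_iff₀ (by positivity) (by positivity)]
    linarith
  nlinarith [norm_nonneg (∑ i, c i • w i), mul_le_mul_of_nonneg_left (h2.trans
    (add_le_add_right hdiff _)) hD0]

/-- A point in the relative interior of a polytope is a convex combination of its generators in
which every weight is positive. -/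
theorem exists_pos_weights_of_zero_mem_intrinsicInterior {a : ι → X}
    (h : (0 : X) ∈ intrinsicInterior ℝ (convexHull ℝ (Set.range a))) :
    ∃ l : ι → ℝ, (∀ i, 0 < l i) ∧ ∑ i, l i = 1 ∧ ∑ i, l i • a i = 0 := by
  classical
  have hmem : ∀ {x : X}, x ∈ convexHull ℝ (Set.range a) →
      ∃ l : ι → ℝ, (∀ i, 0 ≤ l i) ∧ ∑ i, l i = 1 ∧ ∑ i, l i • a i = x := by
    intro x hx
    rw [convexHull_range_eq_exists_affineCombination] at hx
    obtain ⟨s, w, hw0, hw1, hx⟩ := hx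
    rw [Finset.affineCombination_eq_linear_combination _ _ _ hw1] at hx
    refine ⟨fun i => if i ∈ s then w i else 0, fun i => ?_, ?_, ?_⟩
    · dsimp only; split_ifs with hi
      exacts [hw0 i hi, le_rfl]
    · simpa using hw1
    · simpa [ite_smul] using hx
  obtain ⟨y, hy, hy0⟩ := mem_intrinsicInterior.mp h
  have hι : Nonempty ι := by
    by_contra hne
    rw [not_nonempty_iff] at hne
    have := intrinsicInterior_subset h
    simp [Set.range_eq_empty] at this
  -- moving slightly from `0` away from `a i` stays in the polytope
  have hone : ∀ i, ∃ l : ι → ℝ, (∀ j, 0 ≤ l j) ∧ 0 < l i ∧ ∑ j, l j = 1 ∧ ∑ j, l j • a j = 0 := by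
    intro i
    have hai : a i ∈ convexHull ℝ (Set.range a) := subset_convexHull ℝ _ ⟨i, rfl⟩
    let z : affineSpan ℝ (convexHull ℝ (Set.range a)) := ⟨a i, subset_affineSpan ℝ _ hai⟩
    have : Nonempty (affineSpan ℝ (convexHull ℝ (Set.range a))) := ⟨y⟩
    have hcont : Continuous fun t : ℝ =>
        (AffineMap.lineMap y z t : affineSpan ℝ (convexHull ℝ (Set.range a))) :=
      AffineMap.lineMap_continuous
    have hev : ∀ᶠ t : ℝ in 𝓝 0, (AffineMap.lineMap y z t :
        affineSpan ℝ (convexHull ℝ (Set.range a))) ∈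
          ((↑) ⁻¹' (convexHull ℝ (Set.range a)) :
            Set (affineSpan ℝ (convexHull ℝ (Set.range a)))) := by
      apply hcont.continuousAt.eventually_mem
      rw [AffineMap.lineMap_apply_zero]
      exact mem_interior_iff_mem_nhds.mp hy
    obtain ⟨t, ht0, ht⟩ : ∃ t : ℝ, t < 0 ∧ (AffineMap.lineMap y z t :
        affineSpan ℝ (convexHull ℝ (Set.range a))) ∈
          ((↑) ⁻¹' (convexHull ℝ (Set.range a)) :
            Set (affineSpan ℝ (convexHull ℝ (Set.range a)))) := by
      have := (hev.filter_mono nhdsWithin_le_nhds).and (self_mem_nhdsWithin (s := Set.Iio (0 : ℝ)))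
      obtain ⟨t, h1, h2⟩ := this.exists
      exact ⟨t, h2, h1⟩
    have ht' : t • a i ∈ convexHull ℝ (Set.range a) := by
      have : ((AffineMap.lineMap y z t : affineSpan ℝ (convexHull ℝ (Set.range a))) : X)
          = t • a i := by
        simp [AffineMap.lineMap_apply, hy0, z]
      rw [← this]; exact ht
    obtain ⟨m, hm0, hm1, hm⟩ := hmem ht'
    have h1 : 0 < 1 - t := by linarith
    refine ⟨fun j => (1 - t)⁻¹ * (m j + if j = i then -t else 0), fun j => ?_, ?_, ?_, ?_⟩
    · have := hm0 j
      have h2 : 0 ≤ if j = i then -t else 0 := by split_ifs <;> linarith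
      positivity
    · have := hm0 i
      have h2 : 0 < -t := by linarith
      simp only [if_true]
      positivity
    · rw [← Finset.mul_sum, Finset.sum_add_distrib, hm1]
      simp only [Finset.sum_ite_eq', Finset.mem_univ, if_true]
      rw [← sub_eq_add_neg, inv_mul_cancel₀ h1.ne']
    · simp_rw [mul_smul, add_smul, ite_smul, zero_smul]
      rw [← Finset.smul_sum, Finset.sum_add_distrib, hm]
      simp
  choose l hl0 hl hl1 hl2 using hone
  -- the average of these representations of `0` has positive weights throughout
  have hcard : (0 : ℝ) < Fintype.card ι := by exact_mod_cast Fintype.card_pos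
  refine ⟨fun j => (Fintype.card ι : ℝ)⁻¹ * ∑ i, l i j, fun j => ?_, ?_, ?_⟩
  · have : 0 < ∑ i, l i j :=
      Finset.sum_pos' (fun i _ => hl0 i j) ⟨j, Finset.mem_univ _, hl j⟩
    positivity
  · rw [← Finset.mul_sum, Finset.sum_comm]
    simp [hl1, hcard.ne']
  · simp_rw [mul_smul, Finset.sum_smul]
    rw [← Finset.smul_sum, Finset.sum_comm]
    simp [hl2]

end EuclideanGeometry

/-! ### First and second order estimates for `C²` functions -/

section SecondOrder

variable {X : Type*} [NormedAddCommGroup X] [InnerProductSpace ℝ X] [FiniteDimensional ℝ X]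

theorem ContDiff.contDiff_gradient {f : X → ℝ} (hf : ContDiff ℝ 2 f) :
    ContDiff ℝ 1 (gradient f) := by
  have h : gradient f = fun y => ∑ i, (fderiv ℝ f y (stdOrthonormalBasis ℝ X i)) •
      stdOrthonormalBasis ℝ X i := by
    ext1 y
    conv_lhs => rw [← (stdOrthonormalBasis ℝ X).sum_repr' (gradient f y)]
    simp [inner_gradient_right]
  rw [h]
  refine ContDiff.sum fun i _ => ContDiff.smul ?_ contDiff_const
  exact (hf.fderiv_right (m := 1) (by norm_num)).clm_apply contDiff_const

/-- A common Lipschitz constant, on a common ball, for finitely many `C²` functions and their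
gradients. -/
theorem exists_uniform_lipschitz_ball {ι : Type*} [Finite ι] {F : ι → X → ℝ}
    (hF : ∀ i, ContDiff ℝ 2 (F i)) (xbar : X) :
    ∃ K ρ : ℝ, 0 < K ∧ 0 < ρ ∧ (∀ i, ∀ y ∈ Metric.ball xbar ρ, ∀ z ∈ Metric.ball xbar ρ,
      |F i y - F i z| ≤ K * ‖y - z‖) ∧ (∀ i, ∀ y ∈ Metric.ball xbar ρ, ∀ z ∈ Metric.ball xbar ρ,
      ‖gradient (F i) y - gradient (F i) z‖ ≤ K * ‖y - z‖) := by
  have := Fintype.ofFinite ι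
  choose K s hs hK using fun i => ((hF i).of_le (by norm_num) :
    ContDiff ℝ 1 (F i)).contDiffAt.exists_lipschitzOnWith (x := xbar)
  choose K' s' hs' hK' using fun i =>
    (hF i).contDiff_gradient.contDiffAt.exists_lipschitzOnWith (x := xbar)
  have hnhds : (⋂ i, s i ∩ s' i) ∈ 𝓝 xbar := by
    rw [Filter.iInter_mem]; exact fun i => inter_mem (hs i) (hs' i)
  obtain ⟨ρ, hρ, hball⟩ := Metric.mem_nhds_iff.mp hnhds
  set C : ℝ := ∑ i, ((K i : ℝ) + K' i) with hC
  have hCle : ∀ i, (K i : ℝ) + K' i ≤ C := fun i =>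
    Finset.single_le_sum (f := fun i => (K i : ℝ) + K' i) (fun j _ => by positivity)
      (Finset.mem_univ i)
  have hC0 : 0 ≤ C := Finset.sum_nonneg fun j _ => by positivity
  refine ⟨C + 1, ρ, by linarith, hρ, fun i y hy z hz => ?_, fun i y hy z hz => ?_⟩
  · have h := (hK i).norm_sub_le (Set.mem_iInter.mp (hball hy) i).1
      (Set.mem_iInter.mp (hball hz) i).1
    refine h.trans ?_
    gcongr
    have := hCle i; have := (K' i).2; simp only [NNReal.val_eq_coe] at this; linarith
  · have h := (hK' i).norm_sub_le (Set.mem_iInter.mp (hball hy) i).2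
      (Set.mem_iInter.mp (hball hz) i).2
    refine h.trans ?_
    gcongr
    have := hCle i; have := (K i).2; simp only [NNReal.val_eq_coe] at this; linarith

theorem Convex.abs_sub_sub_inner_gradient_le {f : X → ℝ} {s : Set X} {K : ℝ} (hs : Convex ℝ s)
    (hK : 0 ≤ K) (hf : Differentiable ℝ f)
    (hlip : ∀ y ∈ s, ∀ z ∈ s, ‖gradient f y - gradient f z‖ ≤ K * ‖y - z‖) {p y : X}
    (hp : p ∈ s) (hy : y ∈ s) :
    |f y - f p - inner ℝ (gradient f p) (y - p)| ≤ K * ‖y - p‖ ^ 2 := by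
  have h := (hs.inter (convex_closedBall p ‖y - p‖)).norm_image_sub_le_of_norm_hasFDerivWithin_le'
    (f := f) (f' := fun z => fderiv ℝ f z) (φ := fderiv ℝ f p) (C := K * ‖y - p‖) (x := p) (y := y)
    (fun z _ => (hf z).hasFDerivAt.hasFDerivWithinAt) (fun z hz => ?_)
    ⟨hp, by simp⟩ ⟨hy, by simp [dist_eq_norm]⟩
  · rw [inner_gradient_left, ← Real.norm_eq_abs]
    refine h.trans_eq (by ring)
  · rw [← toDual_gradient, ← toDual_gradient, ← map_sub, LinearIsometryEquiv.norm_map]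
    refine (hlip z hz.1 p hp).trans ?_
    have := hz.2
    rw [Metric.mem_closedBall, dist_eq_norm] at this
    gcongr

/-- Near a critical point, a `C²` function is half of the pairing of its gradient with the
displacement, up to an error of order higher than two. -/
theorem eventually_abs_sub_half_inner_gradient_le {L : X → ℝ} (hL : ContDiff ℝ 2 L)
    {xbar : X} (h0 : gradient L xbar = 0) {η : ℝ} (hη : 0 < η) :
    ∀ᶠ p in 𝓝 xbar, |L p - L xbar - 1 / 2 * inner ℝ (gradient L p) (p - xbar)| ≤
      η * ‖p - xbar‖ ^ 2 := by
  set H := fderiv ℝ (gradient L) xbar with hH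
  have hder : HasFDerivAt (gradient L) H xbar :=
    (hL.contDiff_gradient.differentiable (by norm_num) xbar).hasFDerivAt
  have hev := hder.isLittleO.def (half_pos hη)
  simp only [h0, sub_zero] at hev
  obtain ⟨ρ, hρ, hball⟩ := Metric.eventually_nhds_iff_ball.mp hev
  filter_upwards [Metric.ball_mem_nhds xbar hρ] with p hp
  set h := p - xbar with hh
  -- along the segment, subtract the quadratic model and bound the derivative of the difference
  have hphi : ∀ t ∈ Set.Icc (0 : ℝ) 1, HasDerivWithinAt
      (fun t : ℝ => L (xbar + t • h) - t ^ 2 / 2 * inner ℝ (H h) h)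
      (inner ℝ (gradient L (xbar + t • h) - t • H h) h) (Set.Icc 0 1) t := by
    intro t _
    have h1 : HasDerivAt (fun t : ℝ => xbar + t • h) h t := by
      simpa using ((hasDerivAt_id t).smul_const h).const_add xbar
    have h2 : HasDerivAt (fun t : ℝ => L (xbar + t • h))
        (fderiv ℝ L (xbar + t • h) h) t :=
      ((hL.differentiable (by norm_num) (xbar + t • h)).hasFDerivAt).comp_hasDerivAt t h1
    have h3 : HasDerivAt (fun t : ℝ => t ^ 2 / 2 * inner ℝ (H h) h) (t * inner ℝ (H h) h) t := by
      have := (((hasDerivAt_id t).pow 2).div_const 2).mul_const (inner ℝ (H h) h)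
      simpa using this
    have h4 := (h2.sub h3).hasDerivWithinAt (s := Set.Icc 0 1)
    rw [inner_sub_left, inner_gradient_left, real_inner_smul_left]
    exact h4
  have hbound : ∀ t ∈ Set.Ico (0 : ℝ) 1,
      ‖inner ℝ (gradient L (xbar + t • h) - t • H h) h‖ ≤ η / 2 * ‖h‖ ^ 2 := by
    intro t ht
    have hnorm : ‖t • h‖ ≤ ‖h‖ := by
      rw [norm_smul, Real.norm_of_nonneg ht.1]
      exact mul_le_of_le_one_left (norm_nonneg _) ht.2.le
    have hmem : xbar + t • h ∈ Metric.ball xbar ρ := by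
      rw [Metric.mem_ball, dist_eq_norm] at hp ⊢
      simpa using hnorm.trans_lt hp
    have h1 := hball _ hmem
    rw [add_sub_cancel_left, map_smul] at h1
    calc _ ≤ ‖gradient L (xbar + t • h) - t • H h‖ * ‖h‖ := norm_inner_le_norm _ _
      _ ≤ (η / 2 * ‖h‖) * ‖h‖ := by
        gcongr
        exact h1.trans (by gcongr)
      _ = _ := by ring
  have h1 := norm_image_sub_le_of_norm_deriv_le_segment_01' hphi hbound
  have h2 : |inner ℝ (gradient L p - H h) h| ≤ η / 2 * ‖h‖ ^ 2 := by
    calc _ ≤ ‖gradient L p - H h‖ * ‖h‖ := abs_real_inner_le_norm _ _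
      _ ≤ (η / 2 * ‖h‖) * ‖h‖ := by gcongr; exact hball p hp
      _ = _ := by ring
  rw [inner_sub_left] at h2
  simp only [one_smul, zero_smul, add_zero, Real.norm_eq_abs] at h1
  rw [show xbar + h = p by simp [hh]] at h1
  rw [abs_le] at h1 h2 ⊢
  constructor <;> linarith [h1.1, h1.2, h2.1, h2.2]

end SecondOrder

/-! ### The Clarke subdifferential of a finite maximum -/

section ClarkeOfMax

variable {X : Type*} [NormedAddCommGroup X] [InnerProductSpace ℝ X] [FiniteDimensional ℝ X]
variable {ι : Type*} {f : X → ℝ} {F : ι → X → ℝ}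

/-- The limits of gradients of `f` at points of differentiability converging to `x`. -/
def limitingGradients (f : X → ℝ) (x : X) : Set X :=
  {v : X | ∃ u : ℕ → X, (∀ r, DifferentiableAt ℝ f (u r)) ∧ Tendsto u atTop (𝓝 x) ∧
    Tendsto (fun r => gradient f (u r)) atTop (𝓝 v)}

theorem limitingGradients_subset_clarkeSubdifferential (f : X → ℝ) (x : X) :
    limitingGradients f x ⊆ clarkeSubdifferential f x :=
  (subset_convexHull ℝ _).trans subset_closure

/-- The gradients at `y` of the active pieces that belong to the Clarke subdifferential. -/
def activeGradients (f : X → ℝ) (F : ι → X → ℝ) (y : X) : Set X :=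
  {w | ∃ i, w = gradient (F i) y ∧ w ∈ clarkeSubdifferential f y ∧ ∀ j, F j y ≤ F i y}

/-- Where a maximum of smooth functions is differentiable, its gradient is that of every active
piece. -/
theorem gradient_eq_of_isGreatest {u : X} {i : ι}
    (hmax : ∀ᶠ x in 𝓝 u, IsGreatest (Set.range fun i => F i x) (f x))
    (hf : DifferentiableAt ℝ f u) (hF : DifferentiableAt ℝ (F i) u) (hi : F i u = f u) :
    gradient f u = gradient (F i) u := by
  -- `f - F i` is nonnegative and vanishes at `u`
  have hmin : IsLocalMin (fun x => f x - F i x) u := by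
    filter_upwards [hmax] with x hx
    rw [hi, sub_self, sub_nonneg]
    exact hx.2 ⟨i, rfl⟩
  have h := hmin.fderiv_eq_zero
  rw [fderiv_fun_sub hf hF, sub_eq_zero] at h
  simp only [gradient, h]

variable [Finite ι]

theorem clarkeSubdifferential_subset_convexHull_activeGradients {y : X}
    (hmax : ∀ᶠ x in 𝓝 y, IsGreatest (Set.range fun i => F i x) (f x))
    (hF : ∀ i, ContDiff ℝ 2 (F i)) :
    clarkeSubdifferential f y ⊆ convexHull ℝ (activeGradients f F y) := by
  have hfin : (activeGradients f F y).Finite := by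
    refine (Set.finite_range fun i => gradient (F i) y).subset ?_
    rintro w ⟨i, rfl, -⟩
    exact ⟨i, rfl⟩
  refine closure_minimal (convexHull_mono ?_) (hfin.isClosed_convexHull (𝕜 := ℝ))
  intro v hv
  have hvC := limitingGradients_subset_clarkeSubdifferential f y hv
  obtain ⟨u, hu, huy, huv⟩ := hv
  have hev : ∀ᶠ r in atTop, ∃ i, gradient f (u r) = gradient (F i) (u r) ∧
      ∀ j, F j (u r) ≤ F i (u r) := by
    filter_upwards [huy.eventually hmax.eventually_nhds] with r hr
    obtain ⟨i, hi⟩ := hr.self_of_nhds.1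
    refine ⟨i, gradient_eq_of_isGreatest hr (hu r)
      (((hF i).differentiable (by norm_num)) _) hi, fun j => ?_⟩
    have hle : F j (u r) ≤ f (u r) := hr.self_of_nhds.2 ⟨j, rfl⟩
    exact hle.trans_eq hi.symm
  -- one and the same piece is active infinitely often
  obtain ⟨i, hi⟩ := Filter.frequently_exists.mp hev.frequently
  have hgr : Tendsto (fun r => gradient (F i) (u r)) atTop (𝓝 (gradient (F i) y)) :=
    ((hF i).contDiff_gradient.continuous.tendsto y).comp huy
  refine ⟨i, tendsto_nhds_unique_of_frequently_eq huv hgr (hi.mono fun r h => h.1), hvC,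
    fun j => ?_⟩
  exact le_of_tendsto_of_tendsto_of_frequently (((hF j).continuous.tendsto y).comp huy)
    (((hF i).continuous.tendsto y).comp huy) (hi.mono fun r h => h.2 j)

/-- If all pieces agree at `xbar` and their gradients are affinely independent, then every piece
is strictly the largest one on an open set accumulating at `xbar`, so that its gradient is a
limiting gradient. -/
theorem gradient_mem_clarkeSubdifferential {xbar : X}
    (hmax : ∀ᶠ x in 𝓝 xbar, IsGreatest (Set.range fun i => F i x) (f x))
    (hF : ∀ i, ContDiff ℝ 2 (F i)) (hval : ∀ i j, F i xbar = F j xbar)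
    (haff : AffineIndependent ℝ fun i => gradient (F i) xbar) (i : ι) :
    gradient (F i) xbar ∈ clarkeSubdifferential f xbar := by
  apply limitingGradients_subset_clarkeSubdifferential
  obtain ⟨d, hd⟩ := haff.exists_inner_sub_eq i fun _ => -1
  have hline : Tendsto (fun t : ℝ => xbar + t • d) (𝓝[>] 0) (𝓝 xbar) := by
    have : Continuous fun t : ℝ => xbar + t • d := by fun_prop
    simpa using (this.tendsto 0).mono_left nhdsWithin_le_nhds
  have hlt : ∀ j, j ≠ i → ∀ᶠ t : ℝ in 𝓝[>] 0, F j (xbar + t • d) < F i (xbar + t • d) := by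
    intro j hj
    have hdiff : ∀ k, HasDerivAt (fun t : ℝ => F k (xbar + t • d))
        (inner ℝ (gradient (F k) xbar) d) 0 := by
      intro k
      have h1 : HasDerivAt (fun t : ℝ => xbar + t • d) d 0 := by
        simpa using ((hasDerivAt_id (0 : ℝ)).smul_const d).const_add xbar
      have h2 : HasFDerivAt (F k) (fderiv ℝ (F k) xbar) (xbar + (0 : ℝ) • d) := by
        simpa using ((hF k).differentiable (by norm_num) xbar).hasFDerivAt
      rw [inner_gradient_left]
      exact h2.comp_hasDerivAt 0 h1
    have hs := (hdiff j).sub (hdiff i)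
    rw [← inner_sub_left, hd j hj, hasDerivAt_iff_tendsto_slope] at hs
    have hneg := (hs.eventually (gt_mem_nhds (show (-1 : ℝ) < 0 by norm_num))).filter_mono
      (nhdsWithin_mono 0 (fun t (ht : 0 < t) => ht.ne'))
    filter_upwards [hneg, self_mem_nhdsWithin] with t ht ht0
    have ht0' : (0 : ℝ) < t := ht0
    simp only [slope, sub_zero, vsub_eq_sub, smul_eq_mul, Pi.sub_apply, zero_smul, add_zero,
      hval j i, sub_self] at ht
    have := (mul_neg_iff.mp ht).resolve_right (fun h => absurd h.1 (not_lt.mpr (by positivity)))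
    linarith [this.2]
  have hall : ∀ᶠ t : ℝ in 𝓝[>] 0, f =ᶠ[𝓝 (xbar + t • d)] F i := by
    filter_upwards [hline.eventually hmax.eventually_nhds,
      eventually_all.mpr fun j => eventually_imp_distrib_left.mpr (hlt j)] with t h1 h2
    have h3 : ∀ᶠ x in 𝓝 (xbar + t • d), ∀ j, j ≠ i → F j x < F i x :=
      eventually_all.mpr fun j => eventually_imp_distrib_left.mpr fun hj =>
        ((hF j).continuous.continuousAt).eventually_lt ((hF i).continuous.continuousAt) (h2 j hj)
    filter_upwards [h1, h3] with x hx1 hx2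
    obtain ⟨k, hk⟩ := hx1.1
    have hik : F i x ≤ f x := hx1.2 ⟨i, rfl⟩
    by_cases hki : k = i
    · rw [← hk, hki]
    · exact absurd (hx2 k hki) (not_lt.mpr (hik.trans_eq hk.symm))
  obtain ⟨T, hT, hTsub⟩ := mem_nhdsGT_iff_exists_Ioo_subset.mp hall
  have hT0 : (0 : ℝ) < T := hT
  have htT : Tendsto (fun r : ℕ => T / ((r : ℝ) + 2)) atTop (𝓝[>] 0) := by
    refine tendsto_nhdsWithin_iff.mpr ⟨?_, Eventually.of_forall fun r => ?_⟩
    · exact tendsto_const_nhds.div_atTop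
        (tendsto_atTop_add_const_right _ _ tendsto_natCast_atTop_atTop)
    · exact Set.mem_Ioi.mpr (by positivity)
  have hmem : ∀ r : ℕ, f =ᶠ[𝓝 (xbar + (T / ((r : ℝ) + 2)) • d)] F i := fun r =>
    hTsub ⟨by positivity, by
      rw [div_lt_iff₀ (by positivity)]
      nlinarith [(Nat.cast_nonneg r : (0 : ℝ) ≤ r)]⟩
  refine ⟨fun r : ℕ => xbar + (T / ((r : ℝ) + 2)) • d, fun r => ?_, hline.comp htT, ?_⟩
  · exact ((hF i).differentiable (by norm_num) (_ : X)).congr_of_eventuallyEq (hmem r)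
  · simp_rw [fun r => (hmem r).gradient_eq]
    exact ((hF i).contDiff_gradient.continuous.tendsto xbar).comp (hline.comp htT)

/-- The convex weights that exhibit the nondegenerate criticality of a strong `C²` max function. -/
theorem IsStrongC2MaxFunction.exists_pos_multipliers [Fintype ι] {xbar : X}
    (h : IsStrongC2MaxFunction f F xbar) :
    ∃ l : ι → ℝ, (∀ i, 0 < l i) ∧ ∑ i, l i = 1 ∧ ∑ i, l i • gradient (F i) xbar = 0 := by
  apply exists_pos_weights_of_zero_mem_intrinsicInterior
  have heq : clarkeSubdifferential f xbar =
      convexHull ℝ (Set.range fun i => gradient (F i) xbar) := by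
    refine Set.Subset.antisymm ?_ ?_
    · refine (clarkeSubdifferential_subset_convexHull_activeGradients h.eq_max h.contDiff).trans
        (convexHull_mono ?_)
      rintro w ⟨i, rfl, -⟩
      exact ⟨i, rfl⟩
    · refine convexHull_min ?_ (convex_convexHull ℝ _).closure
      rintro _ ⟨i, rfl⟩
      exact gradient_mem_clarkeSubdifferential h.eq_max h.contDiff h.values_eq
        h.affineIndependent i
  rw [← heq]
  exact h.nondegenerate

end ClarkeOfMax

/-! ### Metric regularity and tangent directions of zero sets -/

section MetricRegularity

variable {E G : Type*} [NormedAddCommGroup E] [NormedSpace ℝ E]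
  [NormedAddCommGroup G] [NormedSpace ℝ G]

/-- Metric regularity: near a zero with surjective derivative, the distance to the zero set is
controlled by the size of the values. -/
theorem HasStrictFDerivAt.exists_zero_norm_sub_le [CompleteSpace E] [CompleteSpace G]
    {Φ : E → G} {Φ' : E →L[ℝ] G} {xbar : E}
    (hΦ : HasStrictFDerivAt Φ Φ' xbar) (hsurj : Function.Surjective Φ') (h0 : Φ xbar = 0) :
    ∃ C : ℝ, 0 < C ∧ ∀ᶠ x in 𝓝 xbar, ∃ y, Φ y = 0 ∧ ‖x - y‖ ≤ C * ‖Φ x‖ := by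
  have hrange : Φ'.range = ⊤ := LinearMap.range_eq_top.mpr hsurj
  set R := Φ'.nonlinearRightInverseOfSurjective hrange
  have hR : 0 < R.nnnorm := Φ'.nonlinearRightInverseOfSurjective_nnnorm_pos hrange
  have hR' : (0 : ℝ) < R.nnnorm := hR
  obtain ⟨s, hs, happrox⟩ := hΦ.approximates_deriv_on_nhds (c := R.nnnorm⁻¹ / 2)
    (Or.inr (by positivity))
  obtain ⟨ρ, hρ, hball⟩ := Metric.mem_nhds_iff.mp hs
  set m : ℝ := (R.nnnorm : ℝ)⁻¹ / 2 with hm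
  have hm0 : 0 < m := by positivity
  refine ⟨1 / m, by positivity, ?_⟩
  have hcont : Tendsto (fun x => ‖Φ x‖) (𝓝 xbar) (𝓝 0) := by
    simpa [h0] using hΦ.continuousAt.norm.tendsto
  filter_upwards [Metric.ball_mem_nhds xbar (half_pos hρ),
    hcont.eventually (gt_mem_nhds (show 0 < m * (ρ / 2) by positivity))] with x hx hΦx
  have hr : ‖Φ x‖ / m < ρ / 2 := by rwa [div_lt_iff₀' hm0]
  have hsub : Metric.closedBall x (‖Φ x‖ / m) ⊆ s := fun z hz => hball (by
    rw [Metric.mem_closedBall] at hz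
    rw [Metric.mem_ball] at hx ⊢
    linarith [dist_triangle z x xbar])
  have hsurjOn := happrox.surjOn_closedBall_of_nonlinearRightInverse R (by positivity) hsub
  obtain ⟨y, hy, hy0⟩ := hsurjOn (show (0 : G) ∈ _ by
    rw [Metric.mem_closedBall, dist_zero_left]
    push_cast
    rw [show (R.nnnorm : ℝ)⁻¹ - (R.nnnorm : ℝ)⁻¹ / 2 = m by rw [hm]; ring,
      mul_div_cancel₀ _ hm0.ne'])
  refine ⟨y, hy0, ?_⟩
  rw [Metric.mem_closedBall, dist_comm, dist_eq_norm] at hy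
  exact hy.trans_eq (by ring)

/-- If the distance to the zero set is controlled by the values, then the kernel of the derivative
consists of tangent directions to the zero set. -/
theorem HasFDerivAt.mem_posTangentConeAt_of_apply_eq_zero {Φ : E → G} {Φ' : E →L[ℝ] G} {p u : E}
    {C : ℝ} (hΦ : HasFDerivAt Φ Φ' p) (h0 : Φ p = 0)
    (hreg : ∀ᶠ x in 𝓝 p, ∃ y, Φ y = 0 ∧ ‖x - y‖ ≤ C * ‖Φ x‖) (hu : Φ' u = 0) :
    u ∈ posTangentConeAt {x | Φ x = 0} p := by
  have hlim : Tendsto (fun n : ℕ => (n : ℝ) • Φ (p + (n : ℝ)⁻¹ • u)) atTop (𝓝 0) := by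
    have := (hΦ.lim_real u).comp (tendsto_natCast_atTop_atTop (R := ℝ))
    simpa [h0, hu, Function.comp_def] using this
  have hinv : Tendsto (fun n : ℕ => (n : ℝ)⁻¹ • u) atTop (𝓝 0) := by
    simpa using (tendsto_inv_atTop_nhds_zero_nat (𝕜 := ℝ)).smul_const u
  have hp : Tendsto (fun n : ℕ => p + (n : ℝ)⁻¹ • u) atTop (𝓝 p) := by
    simpa using hinv.const_add p
  obtain ⟨y, hy⟩ := (hp.eventually hreg).choice
  have hcd : Tendsto (fun n : ℕ => (n : ℝ) • (y n - p)) atTop (𝓝 u) := by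
    rw [tendsto_iff_norm_sub_tendsto_zero]
    have hbound : Tendsto (fun n : ℕ => C * ‖(n : ℝ) • Φ (p + (n : ℝ)⁻¹ • u)‖) atTop (𝓝 0) := by
      simpa using hlim.norm.const_mul C
    refine squeeze_zero' (Eventually.of_forall fun _ => norm_nonneg _) ?_ hbound
    filter_upwards [hy, eventually_gt_atTop 0] with n hn hn0
    have hn0' : (0 : ℝ) < n := by exact_mod_cast hn0
    have : (n : ℝ) • (y n - p) - u = -((n : ℝ) • (p + (n : ℝ)⁻¹ • u - y n)) := by
      rw [smul_sub, smul_sub, smul_add, smul_inv_smul₀ hn0'.ne']; abel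
    rw [this, norm_neg, norm_smul, norm_smul, Real.norm_of_nonneg hn0'.le]
    calc _ ≤ (n : ℝ) * (C * ‖Φ (p + (n : ℝ)⁻¹ • u)‖) := by gcongr; exact hn.2
      _ = _ := by ring
  refine mem_tangentConeAt_of_seq atTop (fun n : ℕ => (n : NNReal)) (fun n => y n - p) ?_ ?_ ?_
  · have h1 : Tendsto (fun n : ℕ => (n : ℝ)⁻¹ • ((n : ℝ) • (y n - p))) atTop (𝓝 0) := by
      simpa using (tendsto_inv_atTop_nhds_zero_nat (𝕜 := ℝ)).smul hcd
    refine h1.congr' ?_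
    filter_upwards [eventually_gt_atTop 0] with n hn0
    rw [inv_smul_smul₀ (by exact_mod_cast hn0.ne')]
  · filter_upwards [hy] with n hn
    simpa using hn.1
  · simpa [NNReal.smul_def] using hcd

end MetricRegularity

/-! ### The active manifold and its nearest points -/

section ActiveManifold

variable {X : Type*} [NormedAddCommGroup X] [InnerProductSpace ℝ X] [FiniteDimensional ℝ X]
variable {ι : Type*} {F : ι → X → ℝ} {xbar : X}

theorem isClosed_activeManifold {X : Type*} [NormedAddCommGroup X] [InnerProductSpace ℝ X]
    {F : ι → X → ℝ} (hF : ∀ i, ContDiff ℝ 2 (F i)) :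
    IsClosed (activeManifold F) := by
  simp only [activeManifold, Set.ofPred_forall]
  exact isClosed_iInter fun i => isClosed_iInter fun j =>
    isClosed_eq (hF i).continuous (hF j).continuous

theorem exists_isNearestPoint {M : Set X} (hM : IsClosed M) (hne : M.Nonempty) (x : X) :
    ∃ p, IsNearestPoint M x p := by
  obtain ⟨p, hp, hdist⟩ := hM.exists_infDist_eq_dist hne x
  refine ⟨p, hp, fun q hq => ?_⟩
  rw [← dist_eq_norm, ← dist_eq_norm, ← hdist]
  exact Metric.infDist_le_dist_of_mem hq

theorem IsNearestPoint.norm_sub_le_two_mul {X : Type*} [NormedAddCommGroup X] {M : Set X}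
    {x p xbar : X} (h : IsNearestPoint M x p)
    (hxbar : xbar ∈ M) : ‖p - xbar‖ ≤ 2 * ‖x - xbar‖ := by
  have h1 := h.2 xbar hxbar
  have h2 := norm_sub_le_norm_sub_add_norm_sub p x xbar
  rw [norm_sub_rev p x] at h2
  linarith

/-- Properties that hold near `xbar ∈ M` hold at the points of `M` nearest to points near `xbar`. -/
theorem eventually_forall_isNearestPoint {X : Type*} [NormedAddCommGroup X] {M : Set X}
    {P : X → Prop} {xbar : X} (hxbar : xbar ∈ M)
    (hP : ∀ᶠ p in 𝓝 xbar, P p) : ∀ᶠ x in 𝓝 xbar, ∀ p, IsNearestPoint M x p → P p := by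
  obtain ⟨ρ, hρ, hball⟩ := Metric.eventually_nhds_iff_ball.mp hP
  filter_upwards [Metric.ball_mem_nhds xbar (half_pos hρ)] with x hx p hp
  rw [Metric.mem_ball, dist_eq_norm] at hx
  have h1 := hp.norm_sub_le_two_mul hxbar
  refine hball p ?_
  rw [Metric.mem_ball, dist_eq_norm]
  linarith

/-- The displacement to a nearest point makes an obtuse angle with every tangent direction. -/
theorem IsNearestPoint.inner_nonpos {X : Type*} [NormedAddCommGroup X] [InnerProductSpace ℝ X]
    {M : Set X} {x p u : X} (h : IsNearestPoint M x p)
    (hu : u ∈ posTangentConeAt M p) : inner ℝ (x - p) u ≤ 0 := by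
  have hmin : IsLocalMinOn (fun q => ‖x - q‖ ^ 2) M p := by
    refine IsMinOn.localize fun q hq => ?_
    have := h.2 q hq
    simp only [Set.mem_ofPred_eq]
    gcongr
  have hder : HasFDerivAt (fun q => ‖x - q‖ ^ 2)
      (2 • (innerSL ℝ (x - p)).comp (-ContinuousLinearMap.id ℝ X)) p :=
    ((hasFDerivAt_id p).const_sub x).norm_sq
  have := hmin.hasFDerivWithinAt_nonneg hder.hasFDerivWithinAt hu
  have h2 : 0 ≤ 2 * -inner ℝ (x - p) u := by simpa [inner_sub_left] using this
  linarith

/-- The normal space at `p` to the level set on which the values of all `F i` agree. -/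
def normalSpace (F : ι → X → ℝ) (p : X) : Submodule ℝ X :=
  vectorSpan ℝ (Set.range fun i => gradient (F i) p)

/-- A map into a Euclidean space that vanishes exactly on the active manifold: the differences with
the base function `F i₀`. -/
noncomputable def levelMap {X : Type*} {k : ℕ} (F : ι → X → ℝ) (i₀ : ι) (e : Fin k ≃ {j // j ≠ i₀})
    (x : X) : EuclideanSpace ℝ (Fin k) :=
  WithLp.toLp 2 fun l => F (e l) x - F i₀ x

variable {k : ℕ} {i₀ : ι} {e : Fin k ≃ {j // j ≠ i₀}}

theorem contDiff_levelMap {X : Type*} [NormedAddCommGroup X] [InnerProductSpace ℝ X]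
    {F : ι → X → ℝ} (hF : ∀ i, ContDiff ℝ 2 (F i)) : ContDiff ℝ 2 (levelMap F i₀ e) := by
  rw [contDiff_euclidean]
  exact fun l => (hF (e l)).sub (hF i₀)

theorem mem_activeManifold_iff_levelMap_eq_zero {X : Type*} {F : ι → X → ℝ} {x : X} :
    x ∈ activeManifold F ↔ levelMap F i₀ e x = 0 := by
  constructor
  · intro h
    ext l
    simp [levelMap, h (e l) i₀]
  · intro h
    have hj : ∀ j, F j x = F i₀ x := by
      intro j
      by_cases hj : j = i₀
      · rw [hj]
      · have := congrArg (fun v : EuclideanSpace ℝ (Fin k) => v (e.symm ⟨j, hj⟩)) h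
        simpa [levelMap, sub_eq_zero] using this
    exact fun i j => (hj i).trans (hj j).symm

theorem norm_levelMap_le {X : Type*} {F : ι → X → ℝ} {x : X} {b : ℝ}
    (h : ∀ i j, |F i x - F j x| ≤ b) :
    ‖levelMap F i₀ e x‖ ≤ k * b := by
  calc ‖levelMap F i₀ e x‖ = ‖∑ l, levelMap F i₀ e x l • EuclideanSpace.basisFun (Fin k) ℝ l‖ := by
        congr 1
        conv_lhs => rw [← (EuclideanSpace.basisFun (Fin k) ℝ).sum_repr (levelMap F i₀ e x)]
        simp
    _ ≤ ∑ _l : Fin k, b := norm_sum_le_of_le _ fun l _ => by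
        rw [norm_smul, OrthonormalBasis.norm_eq_one, mul_one]
        exact h _ _
    _ = k * b := by simp

theorem fderiv_levelMap_apply (hF : ∀ i, ContDiff ℝ 2 (F i)) (p u : X) (l : Fin k) :
    fderiv ℝ (levelMap F i₀ e) p u l =
      inner ℝ (gradient (F (e l)) p - gradient (F i₀) p) u := by
  have h := ((contDiff_levelMap hF (e := e)).differentiable (by norm_num) p).hasFDerivAt
  have h1 := (EuclideanSpace.proj (𝕜 := ℝ) l).hasFDerivAt.comp p h
  have h2 : HasFDerivAt (fun x => F (e l) x - F i₀ x)
      (fderiv ℝ (F (e l)) p - fderiv ℝ (F i₀) p) p :=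
    ((hF (e l)).differentiable (by norm_num) p).hasFDerivAt.sub
      ((hF i₀).differentiable (by norm_num) p).hasFDerivAt
  have h3 := DFunLike.congr_fun (h1.unique h2) u
  rw [inner_sub_left, inner_gradient_left, inner_gradient_left]
  exact h3

theorem fderiv_levelMap_apply_eq_zero (hF : ∀ i, ContDiff ℝ 2 (F i)) {p u : X}
    (hu : u ∈ (normalSpace F p)ᗮ) : fderiv ℝ (levelMap F i₀ e) p u = 0 := by
  ext l
  rw [fderiv_levelMap_apply hF]
  exact hu _ (vsub_mem_vectorSpan ℝ ⟨_, rfl⟩ ⟨i₀, rfl⟩)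

theorem surjective_fderiv_levelMap (hF : ∀ i, ContDiff ℝ 2 (F i))
    (haff : AffineIndependent ℝ fun i => gradient (F i) xbar) :
    Function.Surjective (fderiv ℝ (levelMap F i₀ e) xbar) := by
  classical
  intro t
  obtain ⟨d, hd⟩ := haff.exists_inner_sub_eq i₀
    fun j => if h : j ≠ i₀ then t (e.symm ⟨j, h⟩) else 0
  refine ⟨d, ?_⟩
  ext l
  rw [fderiv_levelMap_apply hF, hd (e l) (e l).2]
  simp [(e l).2]

variable [Fintype ι]

theorem hasGradientAt_sum_mul (hF : ∀ i, ContDiff ℝ 2 (F i)) (c : ι → ℝ) (p : X) :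
    HasGradientAt (fun x => ∑ i, c i * F i x) (∑ i, c i • gradient (F i) p) p := by
  rw [hasGradientAt_iff_hasFDerivAt]
  have h : HasFDerivAt (fun x => ∑ i, c i * F i x) (∑ i, c i • fderiv ℝ (F i) p) p :=
    HasFDerivAt.fun_sum fun i _ =>
      ((hF i).differentiable (by norm_num) p).hasFDerivAt.const_mul (c i)
  have heq : InnerProductSpace.toDual ℝ X (∑ i, c i • gradient (F i) p) =
      ∑ i, c i • fderiv ℝ (F i) p := by
    ext u
    rw [InnerProductSpace.toDual_apply_apply, sum_inner, sum_apply]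
    simp [inner_gradient_left, real_inner_smul_left]
  rwa [heq]

/-- Normal vectors are orthogonal to chords of the manifold up to a quadratic error. -/
theorem abs_inner_sum_smul_gradient_le {s : Set X} {K : ℝ} (hs : Convex ℝ s) (hK : 0 ≤ K)
    (hF : ∀ i, ContDiff ℝ 2 (F i))
    (hlip : ∀ i, ∀ y ∈ s, ∀ z ∈ s, ‖gradient (F i) y - gradient (F i) z‖ ≤ K * ‖y - z‖)
    {p q : X} (hp : p ∈ activeManifold F) (hq : q ∈ activeManifold F) (hps : p ∈ s) (hqs : q ∈ s)
    {c : ι → ℝ} (hc : ∑ i, c i = 0) :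
    |inner ℝ (∑ i, c i • gradient (F i) p) (q - p)| ≤ (∑ i, |c i|) * (K * ‖q - p‖ ^ 2) := by
  rcases isEmpty_or_nonempty ι with hι | ⟨⟨i₀⟩⟩
  · simp
  have h : inner ℝ (∑ i, c i • gradient (F i) p) (q - p) =
      -∑ i, c i * (F i q - F i p - inner ℝ (gradient (F i) p) (q - p)) := by
    have h1 : ∀ i, c i * (F i q - F i p - inner ℝ (gradient (F i) p) (q - p)) =
        c i * (F i₀ q - F i₀ p) - c i * inner ℝ (gradient (F i) p) (q - p) := by
      intro i; rw [hq i i₀, hp i i₀]; ring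
    simp_rw [h1]
    rw [Finset.sum_sub_distrib, ← Finset.sum_mul, hc, sum_inner]
    simp [real_inner_smul_left]
  rw [h, abs_neg, Finset.sum_mul]
  refine (Finset.abs_sum_le_sum_abs _ _).trans (Finset.sum_le_sum fun i _ => ?_)
  rw [abs_mul]
  gcongr
  exact hs.abs_sub_sub_inner_gradient_le hK ((hF i).differentiable (by norm_num)) (hlip i) hps hqs

theorem eventually_sum_abs_le_of_gradient (hF : ∀ i, ContDiff ℝ 2 (F i))
    (haff : AffineIndependent ℝ fun i => gradient (F i) xbar) :
    ∃ C : ℝ, 0 < C ∧ ∀ᶠ p in 𝓝 xbar, ∀ c : ι → ℝ, ∑ i, c i = 0 →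
      ∑ i, |c i| ≤ C * ‖∑ i, c i • gradient (F i) p‖ := by
  obtain ⟨C, hC, hev⟩ := haff.eventually_sum_abs_le
  have hcont : Continuous fun p i => gradient (F i) p :=
    continuous_pi fun i => (hF i).contDiff_gradient.continuous
  exact ⟨C, hC, (hcont.tendsto xbar).eventually hev⟩

theorem isC2ManifoldAround_activeManifold (hF : ∀ i, ContDiff ℝ 2 (F i))
    (haff : AffineIndependent ℝ fun i => gradient (F i) xbar) [Nonempty ι]
    (hval : ∀ i j, F i xbar = F j xbar) : IsC2ManifoldAround (activeManifold F) xbar := by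
  classical
  obtain ⟨i₀⟩ := ‹Nonempty ι›
  let e := (Fintype.equivFin {j // j ≠ i₀}).symm
  exact ⟨hval, _, levelMap F i₀ e, (contDiff_levelMap hF).contDiffAt,
    surjective_fderiv_levelMap hF haff,
    Eventually.of_forall fun x => mem_activeManifold_iff_levelMap_eq_zero⟩

/-- Linear error bound for the active manifold, and the tangent directions it provides. -/
theorem activeManifold_error_bound_and_tangent [Nonempty ι] (hF : ∀ i, ContDiff ℝ 2 (F i))
    (haff : AffineIndependent ℝ fun i => gradient (F i) xbar)
    (hval : ∀ i j, F i xbar = F j xbar) :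
    ∃ C : ℝ, 0 < C ∧ ∀ᶠ x in 𝓝 xbar,
      (∀ b : ℝ, (∀ i j, |F i x - F j x| ≤ b) → ∃ y ∈ activeManifold F, ‖x - y‖ ≤ C * b) ∧
      (x ∈ activeManifold F → ∀ u ∈ (normalSpace F x)ᗮ,
        u ∈ posTangentConeAt (activeManifold F) x) := by
  classical
  obtain ⟨i₀⟩ := ‹Nonempty ι›
  let e := (Fintype.equivFin {j // j ≠ i₀}).symm
  have hstrict : HasStrictFDerivAt (levelMap F i₀ e) (fderiv ℝ (levelMap F i₀ e) xbar) xbar :=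
    (contDiff_levelMap hF).contDiffAt.hasStrictFDerivAt (by norm_num)
  obtain ⟨C, hC, hev⟩ := hstrict.exists_zero_norm_sub_le (surjective_fderiv_levelMap hF haff)
    (mem_activeManifold_iff_levelMap_eq_zero.mp hval)
  have hset : {x | levelMap F i₀ e x = 0} = activeManifold F :=
    Set.ext fun x => mem_activeManifold_iff_levelMap_eq_zero.symm
  refine ⟨C * (Fintype.card {j // j ≠ i₀} + 1), by positivity, ?_⟩
  filter_upwards [hev.eventually_nhds] with x hx
  refine ⟨fun b hb => ?_, fun hxM u hu => ?_⟩
  · obtain ⟨y, hy0, hy⟩ := hx.self_of_nhds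
    refine ⟨y, mem_activeManifold_iff_levelMap_eq_zero.mpr hy0, hy.trans ?_⟩
    have hb0 : 0 ≤ b := (abs_nonneg _).trans (hb i₀ i₀)
    have h1 := norm_levelMap_le (i₀ := i₀) (e := e) hb
    rw [mul_assoc]
    gcongr
    linarith
  · rw [← hset]
    exact ((contDiff_levelMap hF).differentiable (by norm_num) x).hasFDerivAt
      |>.mem_posTangentConeAt_of_apply_eq_zero (mem_activeManifold_iff_levelMap_eq_zero.mp hxM) hx
        (fderiv_levelMap_apply_eq_zero hF hu)

/-- Near `xbar`, nearest points in the active manifold are unique: the displacement is normal, and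
normal vectors of small length bend the manifold too little to reach a second nearest point. -/
theorem eventually_isNearestPoint_unique [Nonempty ι] (hF : ∀ i, ContDiff ℝ 2 (F i))
    (haff : AffineIndependent ℝ fun i => gradient (F i) xbar)
    (hval : ∀ i j, F i xbar = F j xbar) :
    ∀ᶠ x in 𝓝 xbar, ∀ p q, IsNearestPoint (activeManifold F) x p →
      IsNearestPoint (activeManifold F) x q → q = p := by
  obtain ⟨C, hC, hevC⟩ := eventually_sum_abs_le_of_gradient hF haff
  obtain ⟨_, -, hevT⟩ := activeManifold_error_bound_and_tangent hF haff hval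
  obtain ⟨K, ρ, hK, hρ, -, hlip⟩ := exists_uniform_lipschitz_ball hF xbar
  have hxbar : xbar ∈ activeManifold F := hval
  filter_upwards [eventually_forall_isNearestPoint hxbar hevC,
    eventually_forall_isNearestPoint hxbar hevT,
    eventually_forall_isNearestPoint hxbar (Metric.ball_mem_nhds xbar hρ),
    Metric.ball_mem_nhds xbar (show 0 < 1 / (2 * (C * K)) by positivity)] with
    x hxC hxT hxρ hx p q hp hq
  -- tangent directions come in opposite pairs, so obtuse angles are right angles
  have hnormal : x - p ∈ normalSpace F p := by
    rw [← Submodule.orthogonal_orthogonal (normalSpace F p)]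
    intro u hu
    have h1 := hp.inner_nonpos ((hxT p hp).2 hp.1 u hu)
    have h2 := hp.inner_nonpos ((hxT p hp).2 hp.1 (-u) (neg_mem hu))
    rw [inner_neg_right] at h2
    rw [real_inner_comm]
    linarith
  obtain ⟨c, hc0, hc⟩ := mem_vectorSpan_range_iff_of_fintype.mp hnormal
  have hcsum := hxC p hp c hc0
  rw [hc] at hcsum
  have h1 := abs_inner_sum_smul_gradient_le (convex_ball xbar ρ) hK.le hF hlip hp.1 hq.1
    (hxρ p hp) (hxρ q hq) hc0
  rw [hc] at h1
  have hpq : ‖x - q‖ = ‖x - p‖ := le_antisymm (hq.2 p hp.1) (hp.2 q hq.1)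
  have h2 : ‖x - q‖ ^ 2 = ‖x - p‖ ^ 2 - 2 * inner ℝ (x - p) (q - p) + ‖q - p‖ ^ 2 := by
    rw [← norm_sub_sq_real]; congr 2; abel
  rw [hpq] at h2
  have h3 : ‖x - p‖ ≤ ‖x - xbar‖ := hp.2 xbar hxbar
  rw [Metric.mem_ball, dist_eq_norm, lt_div_iff₀ (by positivity)] at hx
  have h4 : (∑ i, |c i|) * (K * ‖q - p‖ ^ 2) ≤ C * ‖x - xbar‖ * (K * ‖q - p‖ ^ 2) := by
    gcongr
    exact hcsum.trans (by gcongr)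
  have h5 := (le_abs_self _).trans (h1.trans h4)
  by_contra hne
  have h6 : 0 < ‖q - p‖ := norm_pos_iff.mpr (sub_ne_zero.mpr hne)
  have h7 : ‖x - xbar‖ * (2 * (C * K)) * ‖q - p‖ ^ 2 < 1 * ‖q - p‖ ^ 2 := by gcongr
  nlinarith

/-- Along the active manifold, `f` coincides with every affine combination of the pieces, so each
corresponding combination of gradients is a gradient of `f` within the manifold. -/
theorem hasGradientWithinAt_activeManifold {f : X → ℝ} (hF : ∀ i, ContDiff ℝ 2 (F i)) {p : X}
    (hf : ∀ᶠ x in 𝓝 p, IsGreatest (Set.range fun i => F i x) (f x)) (hp : p ∈ activeManifold F)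
    {c : ι → ℝ} (hc : ∑ i, c i = 1) :
    HasGradientWithinAt f (∑ i, c i • gradient (F i) p) (activeManifold F) p := by
  have h : HasGradientWithinAt (fun x => ∑ i, c i * F i x) (∑ i, c i • gradient (F i) p)
      (activeManifold F) p := (hasGradientAt_sum_mul hF c p).hasFDerivAt.hasFDerivWithinAt
  refine h.congr_of_eventuallyEq_of_mem ?_ hp
  filter_upwards [hf.filter_mono nhdsWithin_le_nhds, self_mem_nhdsWithin] with x hx hxM
  obtain ⟨i, hi⟩ := hx.1
  rw [← hi]
  simp only [hxM _ i, ← Finset.sum_mul, hc, one_mul]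

/-! ### The Riemannian gradient near the critical point -/

/-- The Riemannian gradient at `p` is a convex combination of the gradients of the pieces, and by
quadratic growth its length is bounded below by a multiple of the distance to `xbar`. -/
theorem IsStrongC2MaxFunction.exists_riemannian_gradient_weights {f : X → ℝ}
    (h : IsStrongC2MaxFunction f F xbar) :
    ∃ m : ℝ, 0 < m ∧ ∀ᶠ p in 𝓝 xbar, ∃ w : ι → ℝ, (∀ i, 0 ≤ w i) ∧ ∑ i, w i = 1 ∧
      ∑ i, w i • gradient (F i) p ∈ (normalSpace F p)ᗮ ∧
      (p ∈ activeManifold F → m * ‖p - xbar‖ ≤ ‖∑ i, w i • gradient (F i) p‖) := by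
  obtain ⟨l, hl0, hl1, hl⟩ := h.exists_pos_multipliers
  obtain ⟨C, hC, hevC⟩ := eventually_sum_abs_le_of_gradient h.contDiff h.affineIndependent
  obtain ⟨K, ρ, hK, hρ, -, hlip⟩ := exists_uniform_lipschitz_ball h.contDiff xbar
  obtain ⟨δ, hδ, hgrow⟩ := h.growsQuadratically
  set L : X → ℝ := fun x => ∑ i, l i * F i x with hL
  have hLgrad : ∀ p, gradient L p = ∑ i, l i • gradient (F i) p := fun p =>
    (hasGradientAt_sum_mul h.contDiff l p).gradient
  have hLC : ContDiff ℝ 2 L := ContDiff.sum fun i _ => contDiff_const.mul (h.contDiff i)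
  have hL0 : gradient L xbar = 0 := by rw [hLgrad, hl]
  have hLf : ∀ {x}, IsGreatest (Set.range fun i => F i x) (f x) → x ∈ activeManifold F →
      L x = f x := by
    intro x hx hxM
    obtain ⟨i, hi⟩ := hx.1
    rw [← hi]
    simp only [hL, hxM _ i, ← Finset.sum_mul, hl1, one_mul]
  have hsmall : Tendsto (fun p => C * ‖gradient L p‖) (𝓝 xbar) (𝓝 0) := by
    have := ((hLC.contDiff_gradient.continuous.norm.tendsto xbar).const_mul C)
    simpa [hL0] using this
  have hevl : ∀ᶠ p in 𝓝 xbar, ∀ i, C * ‖gradient L p‖ < l i :=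
    eventually_all.mpr fun i => hsmall.eventually (gt_mem_nhds (hl0 i))
  refine ⟨δ / 2, by positivity, ?_⟩
  filter_upwards [hevC, hevl, hsmall.eventually (gt_mem_nhds (show 0 < δ / (4 * K) by positivity)),
    hgrow, h.eq_max, Metric.ball_mem_nhds xbar hρ,
    eventually_abs_sub_half_inner_gradient_le hLC hL0 (show 0 < δ / 8 by positivity)] with
    p hpC hpl hpK hpgrow hpmax hpρ hptaylor
  -- split the gradient of the Lagrangian into its normal and its tangential component
  obtain ⟨c, hc0, hc⟩ := mem_vectorSpan_range_iff_of_fintype.mp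
    ((normalSpace F p).starProjection_apply_mem (gradient L p))
  have hcsum : ∑ i, |c i| ≤ C * ‖gradient L p‖ := by
    refine (hpC c hc0).trans ?_
    rw [hc]
    gcongr
    exact (normalSpace F p).norm_starProjection_apply_le _
  have hw : ∑ i, (l i - c i) • gradient (F i) p =
      gradient L p - (normalSpace F p).starProjection (gradient L p) := by
    simp_rw [sub_smul]
    rw [Finset.sum_sub_distrib, hc, hLgrad]
  refine ⟨fun i => l i - c i, fun i => ?_, ?_, ?_, fun hpM => ?_⟩
  · have h1 : |c i| ≤ ∑ j, |c j| :=
      Finset.single_le_sum (f := fun j => |c j|) (fun j _ => abs_nonneg _) (Finset.mem_univ i)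
    have := hpl i
    have := le_abs_self (c i)
    linarith
  · rw [Finset.sum_sub_distrib, hl1, hc0, sub_zero]
  · rw [hw]
    exact (normalSpace F p).sub_starProjection_mem_orthogonal _
  · rw [hw]
    set v := gradient L p - (normalSpace F p).starProjection (gradient L p) with hv
    have h1 := abs_inner_sum_smul_gradient_le (convex_ball xbar ρ) hK.le h.contDiff hlip hpM
      (show xbar ∈ activeManifold F from h.values_eq) hpρ (Metric.mem_ball_self hρ) hc0
    rw [hc, ← neg_sub p xbar, inner_neg_right, abs_neg, norm_neg] at h1
    have h2 : (∑ i, |c i|) * (K * ‖p - xbar‖ ^ 2) ≤ δ / 4 * ‖p - xbar‖ ^ 2 := by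
      rw [lt_div_iff₀ (by positivity)] at hpK
      rw [← mul_assoc]
      gcongr
      nlinarith [mul_le_mul_of_nonneg_right hcsum hK.le]
    have h3 : inner ℝ (gradient L p) (p - xbar) = inner ℝ v (p - xbar) +
        inner ℝ ((normalSpace F p).starProjection (gradient L p)) (p - xbar) := by
      rw [← inner_add_left, hv, sub_add_cancel]
    rw [← hLf hpmax hpM, ← hLf h.eq_max.self_of_nhds h.values_eq] at hpgrow
    have h4 := (le_abs_self _).trans (h1.trans h2)
    have h5 := (le_abs_self _).trans hptaylor
    have h6 : δ / 2 * ‖p - xbar‖ ^ 2 ≤ inner ℝ v (p - xbar) := by linarith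
    have h7 := h6.trans (real_inner_le_norm v (p - xbar))
    rcases (norm_nonneg (p - xbar)).eq_or_lt with h8 | h8
    · rw [← h8]; simp
    · refine le_of_mul_le_mul_right ?_ h8
      linarith [sq ‖p - xbar‖]

end ActiveManifold

/-! ### Goldstein subgradients of a strong `C²` max function -/

section TemperedGrowthOfMax

variable {X : Type*} [NormedAddCommGroup X] [InnerProductSpace ℝ X] [FiniteDimensional ℝ X]
variable {ι : Type*} [Fintype ι] {f : X → ℝ} {F : ι → X → ℝ} {xbar : X}

theorem isLipschitzAround_of_isGreatest (hF : ∀ i, ContDiff ℝ 2 (F i))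
    (hmax : ∀ᶠ x in 𝓝 xbar, IsGreatest (Set.range fun i => F i x) (f x)) :
    IsLipschitzAround f xbar := by
  obtain ⟨K, ρ, hK, hρ, hlip, -⟩ := exists_uniform_lipschitz_ball hF xbar
  refine ⟨K.toNNReal, Metric.ball xbar ρ ∩ {x | IsGreatest (Set.range fun i => F i x) (f x)},
    inter_mem (Metric.ball_mem_nhds xbar hρ) hmax,
    LipschitzOnWith.of_le_add_mul _ fun x hx y hy => ?_⟩
  obtain ⟨i, hi⟩ := hx.2.1
  have h1 : F i y ≤ f y := hy.2.2 ⟨i, rfl⟩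
  have h2 := (le_abs_self _).trans (hlip i x hx.1 y hy.1)
  have h3 : F i x = f x := hi
  rw [Real.coe_toNNReal _ hK.le, dist_eq_norm]
  linarith

theorem goldsteinSubdifferential_subset_convexHull {x : X} {ε : ℝ} (hF : ∀ i, ContDiff ℝ 2 (F i))
    (hmax : ∀ y ∈ Metric.closedBall x ε,
      ∀ᶠ z in 𝓝 y, IsGreatest (Set.range fun i => F i z) (f z)) :
    goldsteinSubdifferential f ε x ⊆
      convexHull ℝ (⋃ y ∈ Metric.closedBall x ε, activeGradients f F y) := by
  refine convexHull_min (Set.iUnion₂_subset fun y hy => ?_) (convex_convexHull ℝ _)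
  exact (clarkeSubdifferential_subset_convexHull_activeGradients (hmax y hy) hF).trans
    (convexHull_mono (Set.subset_biUnion_of_mem (u := fun y => activeGradients f F y) hy))

/-- Every piece contributes to a small convex combination of active gradients near `xbar`:
by nondegeneracy, omitting the piece `i` leaves gradients that lie in a half-space away from `0`. -/
theorem IsStrongC2MaxFunction.exists_active_of_mem_convexHull
    (h : IsStrongC2MaxFunction f F xbar) :
    ∃ ρ : ℝ, 0 < ρ ∧ ∀ᶠ g in 𝓝 (0 : X), ∀ S ⊆ Metric.ball xbar ρ,
      g ∈ convexHull ℝ (⋃ y ∈ S, activeGradients f F y) → ∀ i, ∃ z ∈ S,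
        gradient (F i) z ∈ clarkeSubdifferential f z ∧ ∀ j, F j z ≤ F i z := by
  obtain ⟨l, hl0, hl1, hl⟩ := h.exists_pos_multipliers
  choose d hd using fun i => h.affineIndependent.exists_inner_sub_eq i fun _ => 1
  classical
  -- the multipliers force the inner products with the remaining gradients to be positive
  have hdl : ∀ i j, j ≠ i → inner ℝ (gradient (F j) xbar) (d i) = l i := by
    intro i
    have h1 : ∀ j, l j * inner ℝ (gradient (F j) xbar) (d i) =
        l j * inner ℝ (gradient (F i) xbar) (d i) + l j - if j = i then l j else 0 := by
      intro j
      split_ifs with hj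
      · rw [hj]; ring
      · have := hd i j hj
        rw [inner_sub_left] at this
        linear_combination l j * this
    have h2 : inner ℝ (∑ j, l j • gradient (F j) xbar) (d i) = 0 := by rw [hl, inner_zero_left]
    rw [sum_inner] at h2
    simp_rw [real_inner_smul_left, h1] at h2
    rw [Finset.sum_sub_distrib, Finset.sum_add_distrib, ← Finset.sum_mul, hl1] at h2
    simp only [Finset.sum_ite_eq', Finset.mem_univ, if_true] at h2
    intro j hj
    have := hd i j hj
    rw [inner_sub_left] at this
    linarith
  have hev : ∀ᶠ y in 𝓝 xbar, ∀ i j, j ≠ i → l i / 2 < inner ℝ (gradient (F j) y) (d i) := by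
    refine eventually_all.mpr fun i => eventually_all.mpr fun j =>
      eventually_imp_distrib_left.mpr fun hj => ?_
    have hc : Continuous fun y => inner ℝ (gradient (F j) y) (d i) :=
      (h.contDiff j).contDiff_gradient.continuous.inner continuous_const
    refine (hc.tendsto xbar).eventually (lt_mem_nhds ?_)
    rw [hdl i j hj]
    linarith [hl0 i]
  obtain ⟨ρ, hρ, hball⟩ := Metric.eventually_nhds_iff_ball.mp hev
  have hg : ∀ᶠ g in 𝓝 (0 : X), ∀ i, inner ℝ g (d i) < l i / 2 := by
    refine eventually_all.mpr fun i => ?_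
    have hc : Continuous fun g : X => inner ℝ g (d i) := by fun_prop
    refine (hc.tendsto 0).eventually (gt_mem_nhds ?_)
    rw [inner_zero_left]
    linarith [hl0 i]
  refine ⟨ρ, hρ, ?_⟩
  filter_upwards [hg] with g hg S hS hgS i
  by_contra! hcon
  have hsub : convexHull ℝ (⋃ y ∈ S, activeGradients f F y) ⊆
      {z | l i / 2 ≤ inner ℝ z (d i)} := by
    refine convexHull_min ?_ (convex_halfSpace_ge
      ⟨fun a b => inner_add_left a b _, fun r a => by rw [real_inner_smul_left, smul_eq_mul]⟩ _)
    refine Set.iUnion₂_subset fun y hy => ?_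
    rintro _ ⟨j, rfl, hjC, hjmax⟩
    have hji : j ≠ i := by
      rintro rfl
      obtain ⟨k, hk⟩ := hcon y hy hjC
      exact absurd (hjmax k) (not_le.mpr hk)
    exact (hball y (hS hy) i j hji).le
  exact absurd (hsub hgS) (not_le.mpr (hg i))

/-- Pointwise form of the comparison: near `xbar`, a small Goldstein subgradient `g` with radius at
most `β ‖x - xbar‖` agrees with the Riemannian gradient `v` at the projection of `x`, up to a
relative error of order `β`. -/
theorem IsStrongC2MaxFunction.exists_goldstein_comparison (h : IsStrongC2MaxFunction f F xbar) :
    ∃ A B : ℝ, 0 < A ∧ 0 < B ∧ ∀ᶠ xg : X × X in 𝓝 xbar ×ˢ 𝓝 0, ∀ β ε : ℝ,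
      0 < β → β < B → xg.1 ≠ xbar → ε ≤ β * ‖xg.1 - xbar‖ →
      IsGoldsteinSubgradient f ε xg.1 xg.2 →
      ∃ p v : X, IsProjection (activeManifold F) xg.1 p ∧
        IsRiemannianGradient f (activeManifold F) p v ∧ v ≠ 0 ∧
        (1 - A * β) * ‖v‖ ^ 2 ≤ inner ℝ xg.2 v ∧ ‖xg.2‖ ≤ (1 + A * β) * ‖v‖ := by
  have hne : Nonempty ι := by
    obtain ⟨i, -⟩ := h.eq_max.self_of_nhds.1
    exact ⟨i⟩
  have hxbar : xbar ∈ activeManifold F := h.values_eq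
  obtain ⟨K, ρ₁, hK, hρ₁, hlip, hgrad⟩ := exists_uniform_lipschitz_ball h.contDiff xbar
  obtain ⟨C, hC, hevC⟩ :=
    activeManifold_error_bound_and_tangent h.contDiff h.affineIndependent h.values_eq
  obtain ⟨m, hm, hevm⟩ := h.exists_riemannian_gradient_weights
  obtain ⟨ρ₂, hρ₂, hevg⟩ := h.exists_active_of_mem_convexHull
  obtain ⟨ρ₃, hρ₃, hmax⟩ := Metric.eventually_nhds_iff_ball.mp h.eq_max.eventually_nhds
  set D : ℝ := K * (1 + 2 * C * K) with hD
  have hD0 : 0 < D := by positivity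
  refine ⟨2 * D / m, min 1 (1 / (4 * C * K)), by positivity, by positivity, ?_⟩
  have hevx := hevC.and <| (eventually_forall_isNearestPoint hxbar hevC).and <|
    (eventually_forall_isNearestPoint hxbar hevm).and <|
    (eventually_forall_isNearestPoint hxbar h.eq_max.eventually_nhds).and <|
    (eventually_forall_isNearestPoint hxbar (Metric.ball_mem_nhds xbar hρ₁)).and
    (eventually_isNearestPoint_unique h.contDiff h.affineIndependent h.values_eq)
  filter_upwards [hevx.prod_mk hevg,
    Eventually.prod_inl (Metric.ball_mem_nhds xbar (half_pos hρ₁)) _,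
    Eventually.prod_inl (Metric.ball_mem_nhds xbar (half_pos hρ₂)) _,
    Eventually.prod_inl (Metric.ball_mem_nhds xbar (half_pos hρ₃)) _]
  rintro ⟨x, g⟩ ⟨⟨hxC, hpC, hpm, hpmax, hpρ, huniq⟩, hg⟩ hx₁ hx₂ hx₃ β ε hβ hβB hxne hε hgold
  dsimp only at *
  have hβ1 : β < 1 := hβB.trans_le (min_le_left _ _)
  have hβ2 : β * (4 * C * K) < 1 := by
    rw [← lt_div_iff₀ (by positivity)]; exact hβB.trans_le (min_le_right _ _)
  have hs : 0 < ‖x - xbar‖ := norm_pos_iff.mpr (sub_ne_zero.mpr hxne)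
  have hsub : ∀ {ρ : ℝ}, x ∈ Metric.ball xbar (ρ / 2) →
      Metric.closedBall x ε ⊆ Metric.ball xbar ρ := by
    intro ρ hx y hy
    rw [Metric.mem_ball, dist_eq_norm] at hx ⊢
    rw [Metric.mem_closedBall, dist_eq_norm] at hy
    have h1 := norm_sub_le_norm_sub_add_norm_sub y x xbar
    nlinarith
  have hxρ : x ∈ Metric.ball xbar ρ₁ := Metric.ball_subset_ball (by linarith) hx₁
  have hgS := goldsteinSubdifferential_subset_convexHull h.contDiff
    (fun y hy => hmax y (hsub hx₃ hy)) hgold.1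
  choose z hzx hzC hzmax using hg _ (hsub hx₂) hgS
  have hε0 : 0 ≤ ε := by
    obtain ⟨i⟩ := hne
    exact dist_nonneg.trans (Metric.mem_closedBall.mp (hzx i))
  -- every piece is active within distance `ε` of `x`, so all values at `x` nearly agree
  have hval : ∀ i j, |F i x - F j x| ≤ 2 * K * ε := by
    have hle : ∀ i j, F j x - F i x ≤ 2 * K * ε := by
      intro i j
      have h1 := hlip i x hxρ (z i) (hsub hx₁ (hzx i))
      have h2 := hlip j x hxρ (z i) (hsub hx₁ (hzx i))
      have h3 : K * ‖x - z i‖ ≤ K * ε := by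
        gcongr
        rw [← dist_eq_norm, dist_comm]
        exact hzx i
      have := hzmax i j
      rw [abs_le] at h1 h2
      linarith [h1.1, h2.2]
    exact fun i j => abs_le.mpr ⟨by linarith [hle i j], hle j i⟩
  obtain ⟨y₀, hy₀M, hy₀⟩ := hxC.1 _ hval
  obtain ⟨p, hp⟩ := exists_isNearestPoint (isClosed_activeManifold h.contDiff) ⟨xbar, hxbar⟩ x
  have hxp : ‖x - p‖ ≤ 2 * C * K * ε := (hp.2 y₀ hy₀M).trans (hy₀.trans_eq (by ring))
  obtain ⟨w, hw0, hw1, hwT, hwm⟩ := hpm p hp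
  set v := ∑ i, w i • gradient (F i) p with hv
  have hpx : ‖x - xbar‖ / 2 ≤ ‖p - xbar‖ := by
    have h1 := norm_sub_le_norm_sub_add_norm_sub x p xbar
    have h2 : 2 * C * K * ε ≤ 2 * C * K * (β * ‖x - xbar‖) := by gcongr
    have h3 : β * (4 * C * K) * ‖x - xbar‖ ≤ 1 * ‖x - xbar‖ := by gcongr
    linarith
  have hvm : m * (‖x - xbar‖ / 2) ≤ ‖v‖ := le_trans (by gcongr) (hwm hp.1)
  have hv0 : 0 < ‖v‖ := lt_of_lt_of_le (by positivity) hvm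
  have hnear : ∀ y ∈ Metric.closedBall x ε, ∀ i,
      ‖gradient (F i) y - gradient (F i) p‖ ≤ 2 * D / m * β * ‖v‖ := by
    intro y hy i
    have h1 := norm_sub_le_norm_sub_add_norm_sub y x p
    have h2 : ‖y - x‖ ≤ ε := by rw [← dist_eq_norm]; exact hy
    calc _ ≤ K * ‖y - p‖ := hgrad i y (hsub hx₁ hy) p (hpρ p hp)
      _ ≤ K * (ε + 2 * C * K * ε) := by gcongr; linarith
      _ = D * ε := by rw [hD]; ring
      _ ≤ D * (β * ‖x - xbar‖) := by gcongr
      _ = 2 * D / m * β * (m * (‖x - xbar‖ / 2)) := by field_simp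
      _ ≤ _ := by gcongr
  -- all gradients at `p` have the same tangential component `v`
  have htan : ∀ i, inner ℝ (gradient (F i) p) v = ‖v‖ ^ 2 := by
    classical
    intro i
    have hmem : gradient (F i) p - v ∈ normalSpace F p := by
      refine mem_vectorSpan_range_iff_of_fintype.mpr ⟨Pi.single i 1 - w, ?_, ?_⟩
      · simp [Finset.sum_sub_distrib, hw1]
      · simp [sub_smul, Finset.sum_sub_distrib, Pi.single_apply, ite_smul, hv]
    have := hwT _ hmem
    rw [inner_sub_left, real_inner_self_eq_norm_sq] at this
    linarith
  refine ⟨p, v, ⟨hp, fun q hq => huniq p q hp hq⟩, ⟨hp.1, ?_,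
    hasGradientWithinAt_activeManifold h.contDiff (hpmax p hp) hp.1 hw1⟩,
    norm_pos_iff.mp hv0, ?_, ?_⟩
  · exact Submodule.subset_span (tangentConeAt_mono_field ((hpC p hp).2 hp.1 v hwT))
  · have hhalf : convexHull ℝ (⋃ y ∈ Metric.closedBall x ε, activeGradients f F y) ⊆
        {u | (1 - 2 * D / m * β) * ‖v‖ ^ 2 ≤ inner ℝ u v} := by
      refine convexHull_min ?_ (convex_halfSpace_ge
        ⟨fun a b => inner_add_left a b _, fun r a => by rw [real_inner_smul_left, smul_eq_mul]⟩ _)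
      refine Set.iUnion₂_subset fun y hy => ?_
      rintro _ ⟨i, rfl, -, -⟩
      have h1 := (abs_real_inner_le_norm (gradient (F i) y - gradient (F i) p) v).trans
        (mul_le_mul_of_nonneg_right (hnear y hy i) hv0.le)
      rw [inner_sub_left, htan i, abs_le] at h1
      simp only [Set.mem_ofPred_eq]
      linarith [h1.1]
    exact hhalf hgS
  -- the same convex weights applied to the active gradients at the points `z i` give a competitor
  · have hcomp : ∑ i, w i • gradient (F i) (z i) ∈ goldsteinSubdifferential f ε x :=
      (convex_convexHull ℝ _).sum_mem (fun i _ => hw0 i) hw1 fun i _ =>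
        subset_convexHull ℝ _ (Set.mem_biUnion (hzx i) (hzC i))
    have hdiff : ‖∑ i, w i • gradient (F i) (z i) - v‖ ≤ 2 * D / m * β * ‖v‖ := by
      rw [hv, ← Finset.sum_sub_distrib, ← hv]
      calc _ ≤ ∑ i, w i * (2 * D / m * β * ‖v‖) := norm_sum_le_of_le _ fun i _ => by
            rw [← smul_sub, norm_smul, Real.norm_of_nonneg (hw0 i)]
            exact mul_le_mul_of_nonneg_left (hnear _ (hzx i) i) (hw0 i)
        _ = _ := by rw [← Finset.sum_mul, hw1, one_mul]
    have h1 := hgold.2 _ hcomp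
    have h2 := norm_le_norm_add_norm_sub' (∑ i, w i • gradient (F i) (z i)) v
    linarith

end TemperedGrowthOfMax

theorem mainTheorem6 {X : Type*} [NormedAddCommGroup X] [InnerProductSpace ℝ X]
    [FiniteDimensional ℝ X] {ι : Type*} [Finite ι] (f : X → ℝ) (F : ι → X → ℝ) (xbar : X)
    (hf : IsStrongC2MaxFunction f F xbar) :
    HasTemperedGrowth f (activeManifold F) xbar := by
  have := Fintype.ofFinite ι
  obtain ⟨i₀, hi₀⟩ := hf.eq_max.self_of_nhds.1
  have hne : Nonempty ι := ⟨i₀⟩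
  refine ⟨isC2ManifoldAround_activeManifold hf.contDiff hf.affineIndependent hf.values_eq,
    isLipschitzAround_of_isGreatest hf.contDiff hf.eq_max,
    ⟨F i₀, (hf.contDiff i₀).contDiffAt, ?_⟩, ?_⟩
  · filter_upwards [hf.eq_max] with x hx hxM
    obtain ⟨i, hi⟩ := hx.1
    exact hi.symm.trans (hxM i i₀)
  intro θ hθ
  obtain ⟨A, B, hA, hB, hev⟩ := hf.exists_goldstein_comparison
  -- angles above `1` impose nothing more than the angle `1`, where the cosine is still below `1`
  set θ' := min θ 1 with hθ'
  have hθ'0 : 0 < θ' := lt_min hθ one_pos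
  have hcos : 0 < 1 - Real.cos θ' := by
    have := Real.cos_lt_cos_of_nonneg_of_le_pi le_rfl
      ((min_le_right θ 1).trans (by linarith [Real.pi_gt_three])) hθ'0
    rw [Real.cos_zero] at this
    linarith
  refine ⟨min B (min (1 / A) ((1 - Real.cos θ') / (2 * A))), by positivity, ?_⟩
  intro β hβ hββ x ε g hxne hx hε hg hg0
  have hβB : β < B := hββ.trans_le (min_le_left _ _)
  have hβ1 : A * β < 1 := by
    rw [mul_comm, ← lt_div_iff₀ hA]
    exact hββ.trans_le ((min_le_right _ _).trans (min_le_left _ _))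
  have hβ2 : 2 * (A * β) < 1 - Real.cos θ' := by
    have := hββ.trans_le ((min_le_right _ _).trans (min_le_right _ _))
    rw [lt_div_iff₀ (by positivity)] at this
    linarith
  filter_upwards [(hx.prodMk hg0).eventually hev] with r hr
  obtain ⟨p, v, hp, hv, hv0, hinner, hnorm⟩ := hr β (ε r) hβ hβB (hxne r) (hε r).2 (hg r)
  obtain ⟨hgr, hangle⟩ :=
    angle_lt_of_inner_ge hθ'0 hv0 (by positivity) hβ1 hβ2 hinner hnorm
  exact ⟨p, v, hp, hv, hgr, hv0, hangle.trans_le (min_le_left _ _)⟩
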